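/- **Theorem (Hoffman ratio-type bound for the quantum $k$-distance chromatic number).** Let $G=(V,E)$ be a finite simple graph on $n\ge 2$ vertices, with adjacency matrix $A$ having eigenvalues $\lambda_1\ge\cdots\ge\lambda_n$ (with multiplicity), and let $k$ be a positive integer. A *quantum $k$-distance $c$-coloring* of $G$ in dimension $d$ is a family of orthogonal projectors $P_{v,h}\in\mathbb{C}^{d\times d}$ ($v\in V$, $h\in\{1,\dots,c\}$; that is, $P_{v,h}^2=P_{v,h}=P_{v,h}^{*}$) such that $\sum_{h=1}^{c}P_{v,h}=I_d$ for every $v\in V$, and $P_{v,h}P_{w,h}=0$ for every $h$ and all distinct $v,w\in V$ with $\operatorname{dist}_G(v,w)\le k$ (vertices in different components have infinite distance). The *quantum $k$-distance chromatic number* $\chi_{kq}(G)$ is the smallest $c$ for which $G$ admits a quantum $k$-distance $c$-coloring in some dimension $d>0$. Let $p\in\mathbb{R}[x]$ be a polynomial of degree at most $k$ such that $p(\lambda_1)>p(\lambda_i)$ for all $i\in\{2,\dots,n\}$. Put $W(p):=\max_{u\in V}(p(A))_{uu}$ and $\lambda(p):=\min_{2\le i\le n}p(\lambda_i)$. Then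 $$\chi_{kq}(G)\;\ge\;\frac{p(\lambda_1)-\lambda(p)}{W(p)-\lambda(p)}.$$ -/

import Mathlib

/-- A quantum `k`-distance `c`-coloring of `G` in dimension `d`: a family of orthogonal projectors
`P v h` in `ℂ^{d × d}`. The extended distance is used, so vertices in different components
(at distance `⊤`) are not constrained. -/
structure IsQuantumDistColoring {V : Type*} (G : SimpleGraph V) (k c d : ℕ)
    (P : V → Fin c → Matrix (Fin d) (Fin d) ℂ) : Prop where
  /-- Each `P v h` is an orthogonal projector: idempotent and Hermitian. -/
  projector : ∀ v h, IsStarProjection (P v h)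
  /-- Completeness. -/
  complete : ∀ v, ∑ h, P v h = 1
  /-- Orthogonality for distinct vertices at distance at most `k`. -/
  orthogonal : ∀ v w, v ≠ w → G.edist v w ≤ (k : ℕ∞) → ∀ h, P v h * P w h = 0

/-- `G` admits a quantum `k`-distance `c`-coloring in some positive dimension. -/
def QuantumDistColorable {V : Type*} (G : SimpleGraph V) (k c : ℕ) : Prop :=
  ∃ d : ℕ, 0 < d ∧ ∃ P : V → Fin c → Matrix (Fin d) (Fin d) ℂ, IsQuantumDistColoring G k c d P

/-- On a finite vertex set there is always such a coloring, with one color per vertex, so the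
minimum in `quantumDistChromaticNumber` is attained. -/
theorem quantumDistColorable_card {V : Type*} [Fintype V] (G : SimpleGraph V) (k : ℕ) :
    QuantumDistColorable G k (Fintype.card V) := by
  classical
  let e := Fintype.equivFin V
  refine ⟨1, one_pos, fun v h => if e v = h then 1 else 0, ?_, ?_, ?_⟩
  · intro v h
    split_ifs
    · exact .one _
    · exact .zero _
  · intro v
    simp
  · intro v w hvw _ h
    split_ifs with h1 h2
    · exact absurd (e.injective (h1.trans h2.symm)) hvw
    all_goals simp

/-- The quantum `k`-distance chromatic number `χ_kq(G)`: the smallest `c` for which `G` admits a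
quantum `k`-distance `c`-coloring. -/
noncomputable def quantumDistChromaticNumber {V : Type*} [Fintype V] (G : SimpleGraph V)
    (k : ℕ) : ℕ :=
  sInf {c : ℕ | QuantumDistColorable G k c}

/-- The adjacency eigenvalues `λ₁ ≥ ⋯ ≥ λₙ` of `G` with multiplicity, in non-increasing order;
`λ_{i+1}` is the value at `i : Fin n`, where `n` is the number of vertices. -/
noncomputable def adjEigenvalue {V : Type*} [Fintype V] [DecidableEq V] (G : SimpleGraph V)
    [DecidableRel G.Adj] : Fin (Fintype.card V) → ℝ :=
  (G.isHermitian_adjMatrix ℝ).eigenvalues₀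

/-- `W(p)`: the maximum diagonal entry of `p(A)`. -/
noncomputable def maxDiag {V : Type*} [Fintype V] [DecidableEq V] (G : SimpleGraph V)
    [DecidableRel G.Adj] (p : Polynomial ℝ) : ℝ :=
  ⨆ u : V, (Polynomial.aeval (G.adjMatrix ℝ) p) u u

/-- `λ(p)`: the minimum of `p(λ_i)` over `2 ≤ i ≤ n`. -/
noncomputable def minEval {V : Type*} [Fintype V] [DecidableEq V] (G : SimpleGraph V)
    [DecidableRel G.Adj] (p : Polynomial ℝ) : ℝ :=
  ⨅ i : {i : Fin (Fintype.card V) // 1 ≤ (i : ℕ)}, p.eval (adjEigenvalue G i)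

/-! Put `M = p(A) - λ(p) I`. It is positive semidefinite, vanishes at pairs farther apart than `k`,
has diagonal at most `W(p) - λ(p)`, and has eigenvalue `p(λ₁) - λ(p)`. A coloring with `c` colors
splits a unit vector `ξ` into the `c` pieces `P v h ξ` at each vertex. In the quadratic form of `M`,
Cauchy–Schwarz over colors costs a factor `c`, and within one color only diagonal terms survive
(`pinching_inequality`). So each eigenvalue of `M` is at most `c` times the diagonal bound
(`QuantumDistColorable.eigenvalue_le`). -/

open scoped MatrixOrder in
/-- If `q` is nonnegative on the eigenvalues of a real symmetric matrix, then `q(A)` is positive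
semidefinite. -/
theorem posSemidef_aeval_of_eval_eigenvalues_nonneg {V : Type*} [Fintype V] [DecidableEq V]
    {A : Matrix V V ℝ} (hA : A.IsHermitian) (q : Polynomial ℝ)
    (hq : ∀ i, 0 ≤ q.eval (hA.eigenvalues i)) :
    (Polynomial.aeval A q).PosSemidef := by
  rw [← Matrix.nonneg_iff_posSemidef, ← cfc_polynomial q A hA.isSelfAdjoint]
  refine cfc_nonneg fun x hx => ?_
  rw [hA.spectrum_real_eq_range_eigenvalues] at hx
  obtain ⟨i, rfl⟩ := hx
  exact hq i

/-- A polynomial in `A` acts on an eigenvector of `A` by evaluation at the eigenvalue. -/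
theorem aeval_mulVec_of_mulVec_eq_smul {V R : Type*} [Fintype V] [DecidableEq V] [CommRing R]
    {A : Matrix V V R} {x : V → R} {μ : R} (hx : A.mulVec x = μ • x) (q : Polynomial R) :
    (Polynomial.aeval A q).mulVec x = q.eval μ • x := by
  induction q using Polynomial.induction_on' with
  | add p q hp hq => simp [Matrix.add_mulVec, hp, hq, add_smul]
  | monomial n a =>
    have h : ∀ n : ℕ, (A ^ n).mulVec x = μ ^ n • x := by
      intro n
      induction n with
      | zero => simp
      | succ n ih => rw [pow_succ, ← Matrix.mulVec_mulVec, hx, Matrix.mulVec_smul, ih, smul_smul,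
          pow_succ, mul_comm]
    rw [Polynomial.aeval_monomial, ← Algebra.smul_def, Matrix.smul_mulVec, h,
      Polynomial.eval_monomial, smul_smul]

/-- The `(v, w)` entry of a polynomial of degree at most `k` in the adjacency matrix vanishes when
`v` and `w` are at distance more than `k`. -/
theorem aeval_adjMatrix_apply_eq_zero {V R : Type*} [Fintype V] [DecidableEq V] [CommRing R]
    (G : SimpleGraph V) [DecidableRel G.Adj] {k : ℕ} {q : Polynomial R} (hq : q.natDegree ≤ k)
    {v w : V} (h : (k : ℕ∞) < G.edist v w) :
    Polynomial.aeval (G.adjMatrix R) q v w = 0 := by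
  rw [Polynomial.aeval_eq_sum_range, Matrix.sum_apply]
  refine Finset.sum_eq_zero fun i hi => ?_
  have : IsEmpty {r : G.Walk v w | r.length = i} := by
    refine ⟨fun r => h.not_ge (r.1.edist_le.trans ?_)⟩
    rw [r.2]
    have := Finset.mem_range.1 hi
    exact_mod_cast (by omega : i ≤ k)
  rw [Matrix.smul_apply, SimpleGraph.adjMatrix_pow_apply_eq_card_walk, Fintype.card_eq_zero]
  simp

/-- The quadratic form of `Bᵀ * B`, extended to vectors in an inner product space. -/
theorem sum_norm_sq_sum_smul {V E : Type*} [Fintype V] [NormedAddCommGroup E]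
    [InnerProductSpace ℝ E] (B : Matrix V V ℝ) (y : V → E) :
    ∑ u, ‖∑ v, B u v • y v‖ ^ 2 = ∑ v, ∑ w, (B.transpose * B) v w * inner ℝ (y v) (y w) := by
  simp_rw [← real_inner_self_eq_norm_sq, sum_inner, inner_sum, real_inner_smul_left,
    real_inner_smul_right, Matrix.mul_apply, Matrix.transpose_apply, Finset.sum_mul]
  rw [Finset.sum_comm]
  refine Finset.sum_congr rfl fun v _ => ?_
  rw [Finset.sum_comm]
  exact Finset.sum_congr rfl fun w _ => Finset.sum_congr rfl fun u _ => by ring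

open scoped MatrixOrder Matrix.Norms.L2Operator in
/-- **Pinching inequality**. Decompose each vector `x v • ξ` as `∑ h, x v • y v h`, such that
`y v h` and `y w h` are orthogonal wherever `M` has a nonzero off-diagonal entry. -/
theorem pinching_inequality {V ι E : Type*} [Fintype V] [DecidableEq V] [Fintype ι]
    [NormedAddCommGroup E] [InnerProductSpace ℝ E] {M : Matrix V V ℝ} (hM : M.PosSemidef)
    (x : V → ℝ) (ξ : E) (y : V → ι → E) (hsum : ∀ v, ∑ h, y v h = ξ)
    (hnorm : ∀ v, ∑ h, ‖y v h‖ ^ 2 = ‖ξ‖ ^ 2)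
    (horth : ∀ v w, v ≠ w → M v w ≠ 0 → ∀ h, inner ℝ (y v h) (y w h) = 0) :
    (x ⬝ᵥ M.mulVec x) * ‖ξ‖ ^ 2 ≤ Fintype.card ι * ((∑ v, M v v * x v ^ 2) * ‖ξ‖ ^ 2) := by
  -- With `M = Bᵀ * B`, the quadratic form at vector-valued arguments is a sum of squared norms.
  obtain ⟨B, hB⟩ := CStarAlgebra.nonneg_iff_eq_star_mul_self.1 hM.nonneg
  rw [Matrix.star_eq_conjTranspose, Matrix.conjTranspose_eq_transpose_of_trivial] at hB
  have hleft : ∑ u, ‖∑ v, B u v • x v • ξ‖ ^ 2 = (x ⬝ᵥ M.mulVec x) * ‖ξ‖ ^ 2 := by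
    rw [sum_norm_sq_sum_smul, ← hB]
    simp_rw [real_inner_smul_left, real_inner_smul_right, real_inner_self_eq_norm_sq, dotProduct,
      Matrix.mulVec, dotProduct, Finset.mul_sum, Finset.sum_mul]
    exact Finset.sum_congr rfl fun v _ => Finset.sum_congr rfl fun w _ => by ring
  have hright (h : ι) : ∑ u, ‖∑ v, B u v • x v • y v h‖ ^ 2 =
      ∑ v, M v v * x v ^ 2 * ‖y v h‖ ^ 2 := by
    rw [sum_norm_sq_sum_smul, ← hB]
    refine Finset.sum_congr rfl fun v _ => ?_
    rw [Finset.sum_eq_single v]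
    · rw [real_inner_smul_left, real_inner_smul_right, real_inner_self_eq_norm_sq]
      ring
    · intro w _ hwv
      rw [real_inner_smul_left, real_inner_smul_right]
      by_cases h0 : M v w = 0
      · simp [h0]
      · simp [horth v w hwv.symm h0 h]
    · simp
  have hsplit (u : V) : ‖∑ v, B u v • x v • ξ‖ ^ 2 ≤
      Fintype.card ι * ∑ h, ‖∑ v, B u v • x v • y v h‖ ^ 2 := by
    have : ∑ v, B u v • x v • ξ = ∑ h, ∑ v, B u v • x v • y v h := by
      rw [Finset.sum_comm]
      simp_rw [← Finset.smul_sum, hsum]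
    rw [this]
    calc _ ≤ (∑ h, ‖∑ v, B u v • x v • y v h‖) ^ 2 := by
          gcongr
          exact norm_sum_le _ _
      _ ≤ _ := sq_sum_le_card_mul_sum_sq
  calc (x ⬝ᵥ M.mulVec x) * ‖ξ‖ ^ 2
      ≤ ∑ u, Fintype.card ι * ∑ h, ‖∑ v, B u v • x v • y v h‖ ^ 2 := by
        rw [← hleft]
        exact Finset.sum_le_sum fun u _ => hsplit u
    _ = _ := by
        rw [← Finset.mul_sum, Finset.sum_comm]
        simp_rw [hright]
        rw [Finset.sum_comm, Finset.sum_mul]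
        simp_rw [← Finset.mul_sum, hnorm]

/-- For a symmetric matrix supported on pairs at distance at most `k`, positive semidefinite and
with diagonal entries at most `W`, every eigenvalue is at most `c * W` if a quantum `k`-distance
`c`-coloring exists. -/
theorem QuantumDistColorable.eigenvalue_le {V : Type*} [Fintype V] [DecidableEq V]
    {G : SimpleGraph V} {k c : ℕ} (hcol : QuantumDistColorable G k c) {M : Matrix V V ℝ}
    (hM : M.PosSemidef) (hsupp : ∀ v w, (k : ℕ∞) < G.edist v w → M v w = 0)
    {W : ℝ} (hW : ∀ v, M v v ≤ W) {x : V → ℝ} (hx0 : x ≠ 0) {μ : ℝ} (hx : M.mulVec x = μ • x) :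
    μ ≤ c * W := by
  obtain ⟨d, hd, P, hP⟩ := hcol
  let ξ : EuclideanSpace ℂ (Fin d) := EuclideanSpace.single ⟨0, hd⟩ 1
  have hξ : ‖ξ‖ ^ 2 = 1 := by simp [ξ]
  let T (v : V) (h : Fin c) := Matrix.toEuclideanCLM (𝕜 := ℂ) (P v h)
  -- This Gram identity yields both the norm condition (`v = w`) and the orthogonality within a
  -- color.
  have hT (v w h) : inner ℂ (T v h ξ) (T w h ξ) =
      inner ℂ ξ (Matrix.toEuclideanCLM (𝕜 := ℂ) (P v h * P w h) ξ) := by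
    have : star (T v h) = T v h := by
      rw [← map_star, (hP.projector v h).isSelfAdjoint.star_eq]
    rw [map_mul, mul_apply_eq_comp]
    change _ = inner ℂ ξ (T v h (T w h ξ))
    rw [← ContinuousLinearMap.adjoint_inner_left (T v h), ← ContinuousLinearMap.star_eq_adjoint,
      this]
  have hsum (v) : ∑ h, T v h = 1 := by rw [← map_sum, hP.complete, map_one]
  have hnorm (v) : ∑ h, ‖T v h ξ‖ ^ 2 = ‖ξ‖ ^ 2 := by
    have h1 : ∀ h, ((‖T v h ξ‖ ^ 2 : ℝ) : ℂ) = inner ℂ ξ (T v h ξ) := by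
      intro h
      have := hT v v h
      rw [(hP.projector v h).isIdempotentElem.eq, inner_self_eq_norm_sq_to_K] at this
      simpa using this
    have h2 : ((∑ h, ‖T v h ξ‖ ^ 2 : ℝ) : ℂ) = ((‖ξ‖ ^ 2 : ℝ) : ℂ) := by
      rw [Complex.ofReal_sum]
      simp_rw [h1]
      rw [← inner_sum, ← sum_apply, hsum, one_apply_eq_self,
        inner_self_eq_norm_sq_to_K]
      simp
    exact_mod_cast h2
  let _ : InnerProductSpace ℝ (EuclideanSpace ℂ (Fin d)) := .rclikeToReal ℂ _
  have key := pinching_inequality hM x ξ (fun v h => T v h ξ)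
    (fun v => by rw [← sum_apply, hsum, one_apply_eq_self])
    hnorm (fun v w hvw hMvw h => by
      have hdist : G.edist v w ≤ k := not_lt.1 fun hlt => hMvw (hsupp v w hlt)
      rw [real_inner_eq_re_inner ℂ, hT, hP.orthogonal v w hvw hdist]
      simp)
  have hpos : 0 < x ⬝ᵥ x := by
    simpa using Matrix.dotProduct_star_self_pos_iff.2 hx0
  rw [hξ, mul_one, mul_one, hx, dotProduct_smul, smul_eq_mul, Fintype.card_fin] at key
  have hdiag : ∑ v, M v v * x v ^ 2 ≤ W * (x ⬝ᵥ x) := by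
    rw [dotProduct, Finset.mul_sum]
    refine Finset.sum_le_sum fun v _ => ?_
    rw [← sq]
    exact mul_le_mul_of_nonneg_right (hW v) (sq_nonneg _)
  refine le_of_mul_le_mul_right (key.trans ?_) hpos
  rw [mul_assoc]
  gcongr

theorem mainTheorem4 {V : Type*} [Fintype V] [DecidableEq V] (G : SimpleGraph V)
    [DecidableRel G.Adj] (hn : 2 ≤ Fintype.card V) (k : ℕ) (p : Polynomial ℝ)
    (hdeg : p.natDegree ≤ k)
    (hp : ∀ i : Fin (Fintype.card V), 1 ≤ (i : ℕ) →
      p.eval (adjEigenvalue G i) < p.eval (adjEigenvalue G ⟨0, by omega⟩)) :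
    (p.eval (adjEigenvalue G ⟨0, by omega⟩) - minEval G p) / (maxDiag G p - minEval G p) ≤
      (quantumDistChromaticNumber G k : ℝ) := by
  have hcol : QuantumDistColorable G k (quantumDistChromaticNumber G k) :=
    Nat.sInf_mem (s := {c | QuantumDistColorable G k c}) ⟨_, quantumDistColorable_card G k⟩
  have hA := G.isHermitian_adjMatrix ℝ
  have hmin (i : Fin (Fintype.card V)) : minEval G p ≤ p.eval (adjEigenvalue G i) := by
    have hle (i : Fin (Fintype.card V)) (hi : 1 ≤ (i : ℕ)) :
        minEval G p ≤ p.eval (adjEigenvalue G i) :=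
      ciInf_le (Set.finite_range fun j : {i : Fin (Fintype.card V) // 1 ≤ (i : ℕ)} =>
        p.eval (adjEigenvalue G j)).bddBelow ⟨i, hi⟩
    by_cases hi : 1 ≤ (i : ℕ)
    · exact hle i hi
    -- The infimum omits `λ₁`, but `p(λ₁)` exceeds `p(λ₂)`, which exists since `n ≥ 2`.
    · have hi0 : i = ⟨0, by omega⟩ := Fin.ext (by simp; omega)
      rw [hi0]
      exact (hle ⟨1, by omega⟩ le_rfl).trans (hp ⟨1, by omega⟩ le_rfl).le
  let q : Polynomial ℝ := p - Polynomial.C (minEval G p)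
  let M : Matrix V V ℝ := Polynomial.aeval (G.adjMatrix ℝ) q
  have hMpos : M.PosSemidef := posSemidef_aeval_of_eval_eigenvalues_nonneg hA q fun i => by
    simpa [q, Matrix.IsHermitian.eigenvalues] using! hmin _
  have hMdiag (v : V) : M v v ≤ maxDiag G p - minEval G p := by
    have : M v v = Polynomial.aeval (G.adjMatrix ℝ) p v v - minEval G p := by
      simp [M, q, Matrix.algebraMap_matrix_apply]
    rw [this]
    exact sub_le_sub_right (le_ciSup (Set.finite_range fun u : V =>
      Polynomial.aeval (G.adjMatrix ℝ) p u u).bddAbove v) _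
  -- The vertex labelling `λ₁` when `eigenvalues` reindexes the sorted list by `V`.
  let j : V := Fintype.equivOfCardEq (Fintype.card_fin _) (⟨0, by omega⟩ : Fin (Fintype.card V))
  have hj : hA.eigenvalues j = adjEigenvalue G ⟨0, by omega⟩ := by
    simp [Matrix.IsHermitian.eigenvalues, j, adjEigenvalue]
  have hbound := hcol.eigenvalue_le hMpos
    (fun v w h => aeval_adjMatrix_apply_eq_zero G
      ((Polynomial.natDegree_sub_C).le.trans hdeg) h) hMdiag
    (x := hA.eigenvectorBasis j)
    (fun h => hA.eigenvectorBasis.toBasis.ne_zero j (by ext i; simpa using congrFun h i))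
    (aeval_mulVec_of_mulVec_eq_smul (hA.mulVec_eigenvectorBasis j) q)
  -- Nonnegativity suffices: a zero denominator would make the quotient `0`.
  have hden : 0 ≤ maxDiag G p - minEval G p := hMpos.diag_nonneg.trans (hMdiag j)
  refine div_le_of_le_mul₀ hden (Nat.cast_nonneg _) ?_
  simpa [hj, q] using hbound
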